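/- All groups and graphs are finite, and graphs are simple. For a positive integer $d$, let $\mathcal A(d)$ be the family of pairs $(\Gamma,G)$ where $\Gamma$ is a connected graph of valency at most $d$ and $G\le \mathrm{Aut}(\Gamma)$ is transitive on the vertex set $V\Gamma$. For $f:\mathbb N\to\mathbb N$, a pair $(\Gamma,G)\in\mathcal A(d)$ is $f$-bounded if $|G_\alpha|\le f(d)$ for every $\alpha\in V\Gamma$. Put $$\widehat f(d)=\Bigl(d\,f(d)^{\,d^{d} f(d)^{2d}}\Bigr)!.$$ Two pairs $(\Gamma,G)$, $(\Gamma',G')$ are isomorphic if some graph isomorphism $\Gamma\to\Gamma'$ conjugates $G$ onto $G'$. A permutation group is quasiprimitive if each of its non-identity normal subgroups is transitive. The socle $\mathrm{Soc}(G)$ is the subgroup generated by the minimal normal subgroups of $G$; for $G$ quasiprimitive it is isomorphic to $T^l$ for some simple group $T$ (possibly abelian), and $T$ is called the socle factor of $G$. For a subgroup $M\le\mathrm{Aut}(\Gamma)$, the graph $\Gamma_M$ has the $M$-orbits on $V\Gamma$ as vertices, two distinct orbits being adjacent if some edge of $\Gamma$ joins a vertex of one to a vertex of the other. Theorem. Let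 $(\Gamma,G)\in\mathcal A(d)$, where $G$ is quasiprimitive on $V\Gamma$ with socle $N$ and socle factor $T$. Then at least one of the following holds. (1) $|G_\alpha|\le (d\,d!)!$ for every $\alpha\in V\Gamma$. (2) $(\Gamma,G)$ uniquely determines, up to isomorphism, a pair $(\Lambda,T)\in\mathcal A(d)$, in the following sense: $\Lambda=\Gamma_M$ for a maximal normal subgroup $M$ of $N$, the group acting on it is the permutation group induced by $N$ on the set of $M$-orbits, and this group is isomorphic to $T$; moreover, any pair obtained in this way from a pair isomorphic to $(\Gamma,G)$, for any choice of the maximal normal subgroup, is isomorphic to $(\Lambda,T)$. For every $g:\mathbb N\to\mathbb N$, if $(\Lambda,T)$ is $g$-bounded then $(\Gamma,G)$ is $\widehat g$-bounded. Conversely, for every $f:\mathbb N\to\mathbb N$, if $(\Gamma,G)$ is $f$-bounded then $(\Lambda,T)$ is $f$-bounded. -/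

import Mathlib

open scoped Nat

universe u v

/-- The automorphism group of a graph, as a group of permutations of its vertices. -/
def graphAut {V : Type*} (Γ : SimpleGraph V) : Subgroup (Equiv.Perm V) where
  carrier := {g | ∀ a b, Γ.Adj (g a) (g b) ↔ Γ.Adj a b}
  one_mem' := fun _ _ => Iff.rfl
  mul_mem' := by
    intro g h hg hh a b
    simpa using (hg (h a) (h b)).trans (hh a b)
  inv_mem' := by
    intro g hg a b
    simpa using (hg (g⁻¹ a) (g⁻¹ b)).symm

/-- The family `𝒜(d)`: connected graphs `Γ` of valency at most `d`, together with a group `G` of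
automorphisms of `Γ` that is transitive on the vertices. -/
structure InFamily (d : ℕ) {V : Type*} (Γ : SimpleGraph V) (G : Subgroup (Equiv.Perm V)) :
    Prop where
  le_aut : G ≤ graphAut Γ
  transitive : MulAction.IsPretransitive G V
  connected : Γ.Connected
  valency_le : ∀ v, (Γ.neighborSet v).Finite ∧ (Γ.neighborSet v).ncard ≤ d

/-- For a pair `(Γ, G)` in `𝒜(d)`: every vertex stabiliser in `G` is finite of order at
most `f d`. -/
def IsBoundedBy (f : ℕ → ℕ) (d : ℕ) {V : Type*} (G : Subgroup (Equiv.Perm V)) : Prop :=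
  ∀ v : V, Finite (MulAction.stabilizer G v) ∧ Nat.card (MulAction.stabilizer G v) ≤ f d

/-- The function `d ↦ (d f(d)^(d^d f(d)^(2d)))!`. -/
def hatFun (f : ℕ → ℕ) (d : ℕ) : ℕ :=
  (d * f d ^ (d ^ d * f d ^ (2 * d)))!

/-- `K` is a minimal normal subgroup. -/
def IsMinimalNormal {G : Type*} [Group G] (K : Subgroup G) : Prop :=
  K.Normal ∧ K ≠ ⊥ ∧ ∀ L : Subgroup G, L.Normal → L ≤ K → L = ⊥ ∨ L = K

/-- `M` is a maximal (proper) normal subgroup. -/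
def IsMaximalNormal {G : Type*} [Group G] (M : Subgroup G) : Prop :=
  M.Normal ∧ M ≠ ⊤ ∧ ∀ L : Subgroup G, L.Normal → M ≤ L → L = M ∨ L = ⊤

/-- The socle: the subgroup generated by all minimal normal subgroups. -/
def socle (G : Type*) [Group G] : Subgroup G :=
  sSup {K | IsMinimalNormal K}

/-- `T` is the socle factor of `G`: it is simple and the socle of `G` is a direct power of `T`. -/
def IsSocleFactor (G : Type*) [Group G] (T : Type*) [Group T] : Prop :=
  IsSimpleGroup T ∧ ∃ l : ℕ, Nonempty (socle G ≃* (Fin l → T))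

/-- The quotient of `Γ` modulo a group `M` acting on its vertices: the vertices are the `M`-orbits,
two distinct orbits being adjacent when some edge of `Γ` joins them. -/
def quotientGraph {V : Type*} (Γ : SimpleGraph V) (M : Type*) [Group M] [MulAction M V] :
    SimpleGraph (MulAction.orbitRel.Quotient M V) where
  Adj x y := x ≠ y ∧ ∃ a b : V, (Quotient.mk _ a : MulAction.orbitRel.Quotient M V) = x ∧
    (Quotient.mk _ b : MulAction.orbitRel.Quotient M V) = y ∧ Γ.Adj a b
  symm := ⟨fun _ _ ⟨hne, a, b, ha, hb, hab⟩ => ⟨hne.symm, b, a, hb, ha, hab.symm⟩⟩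
  loopless := ⟨fun _ h => h.1 rfl⟩

/-- The group of permutations that `N` induces on the set of `M`-orbits, for a (normal) subgroup
`M` of `N`. -/
def inducedGroup (V : Type*) {N : Type*} [Group N] [MulAction N V] (M : Subgroup N) :
    Subgroup (Equiv.Perm (MulAction.orbitRel.Quotient M V)) where
  carrier := {p | ∃ n : N, ∀ v : V, p (Quotient.mk _ v) = Quotient.mk _ (n • v)}
  one_mem' := ⟨1, fun v => by simp⟩
  mul_mem' := by
    rintro p q ⟨m, hm⟩ ⟨n, hn⟩
    exact ⟨m * n, fun v => by rw [Equiv.Perm.mul_apply, hn, hm, mul_smul]⟩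
  inv_mem' := by
    rintro p ⟨n, hn⟩
    exact ⟨n⁻¹, fun v => by rw [Equiv.Perm.inv_eq_iff_eq, hn, smul_inv_smul]⟩

/-- Two pairs (graph, permutation group on its vertices) are isomorphic: some graph isomorphism
carries one group onto the other by conjugation. -/
def PairIso {V W : Type*} (Γ : SimpleGraph V) (G : Subgroup (Equiv.Perm V))
    (Λ : SimpleGraph W) (H : Subgroup (Equiv.Perm W)) : Prop :=
  ∃ e : V ≃ W, (∀ a b, Λ.Adj (e a) (e b) ↔ Γ.Adj a b) ∧
    ∀ g : Equiv.Perm V, g ∈ G ↔ e.permCongr g ∈ H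

/-- `(Λ, H)` is, up to isomorphism, the quotient pair `(Γ_M, N/M)`, where `N` is the socle of `G`
and `M` is a maximal normal subgroup of `N`. -/
def IsSocleQuotientPair {V W : Type*} (Γ : SimpleGraph V) (G : Subgroup (Equiv.Perm V))
    (Λ : SimpleGraph W) (H : Subgroup (Equiv.Perm W)) : Prop :=
  ∃ M : Subgroup (socle G), IsMaximalNormal M ∧
    PairIso (quotientGraph Γ M) (inducedGroup V M) Λ H

/-! ### Normal subgroups and perfect simple quotients. -/

section Groups

/-! If `K` is normal in `G` and transitive, `G_α` acts faithfully by conjugation on the elements of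
`K` moving `α` to a neighbour, so `|G_α| ≤ (d |K_α|)!`. It remains to bound `|K_α|` for a suitable
`K`. An abelian minimal normal subgroup, or one of two distinct (hence commuting) ones, is regular,
which gives (1). Otherwise the socle `N` is minimal normal and perfect. Fix a maximal normal `M` and
`θ : N → Q` with kernel `M`; the `G`-conjugates of `M` intersect trivially, so `N` is controlled by
the twists of `θ`.

If `M` is transitive, every `N_v` maps onto `Q` under every twist. The kernel of `N_v` on the
neighbourhood of `v` is then determined by the twists on which it is nontrivial, and it is the same
for adjacent vertices; so it is trivial and `|N_v| ≤ d!` (`ballStabilizer_eq_bot`).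

If `M` is intransitive, `N_α` has proper image `R` in `Q`, and `R` is a vertex stabiliser of the
quotient pair. The kernel of the twist by `h ∈ G_α` is determined by its values on `d` elements of
`N`, each with at most `d|R|` possibilities. Hence `N_α` embeds in a power of `R` with at most
`(d|R|)^d` factors (`card_stabilizer_le_pow`). Uniqueness of the quotient holds because the maximal
normal subgroups of `N` are conjugate in `G`. -/

theorem map_eq_bot_or_top {B Q : Type*} [Group B] [Group Q] [IsSimpleGroup Q] {θ : B →* Q}
    (hθ : Function.Surjective θ) (K : Subgroup B) (hK : K.Normal) :
    K.map θ = ⊥ ∨ K.map θ = ⊤ :=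
  IsSimpleGroup.eq_bot_or_eq_top_of_normal _ (hK.map θ hθ)

/-- The intersection contains `⁅R, K⁆`, whose image is `⁅Q, Q⁆ = Q`. This is where perfectness
enters. -/
theorem map_inf_eq_top {B Q : Type*} [Group B] [Group Q] {θ : B →* Q}
    (hQ : ⁅(⊤ : Subgroup Q), (⊤ : Subgroup Q)⁆ = ⊤) {R K : Subgroup B} (hR : R.Normal)
    (hK : K.Normal) (h1 : R.map θ = ⊤) (h2 : K.map θ = ⊤) : (R ⊓ K).map θ = ⊤ := by
  have h := Subgroup.map_mono (f := θ) (Subgroup.commutator_le_inf R K)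
  rw [Subgroup.map_commutator, h1, h2, hQ] at h
  exact top_le_iff.1 h

theorem normal_biInf_ker {B ι : Type*} [Group B] {Q : ι → Type*} [∀ i, Group (Q i)]
    (θ : ∀ i, B →* Q i) (s : Set ι) : (⨅ i ∈ s, (θ i).ker).Normal :=
  Subgroup.normal_iInf_normal fun _ => Subgroup.normal_iInf_normal fun _ => inferInstance

theorem map_biInf_ker_eq_top {B ι P : Type*} [Group B] [Group P] {Q : ι → Type*}
    [∀ i, Group (Q i)] (θ : ∀ i, B →* Q i) {ψ : B →* P} (hψ : Function.Surjective ψ)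
    (hP : ⁅(⊤ : Subgroup P), (⊤ : Subgroup P)⁆ = ⊤) {s : Set ι} (hs : s.Finite)
    (h : ∀ i ∈ s, (θ i).ker.map ψ = ⊤) : (⨅ i ∈ s, (θ i).ker).map ψ = ⊤ := by
  induction s, hs using Set.Finite.induction_on with
  | empty => simpa [← MonoidHom.range_eq_map, MonoidHom.range_eq_top] using hψ
  | @insert a s _ _ ih =>
    rw [iInf_insert]
    exact map_inf_eq_top hP inferInstance (normal_biInf_ker θ s) (h a (Set.mem_insert _ _))
      (ih fun i hi => h i (Set.mem_insert_of_mem _ hi))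

/-- A normal subgroup mapping onto each of finitely many perfect simple quotients supplements the
intersection of the kernels. -/
theorem exists_mul_of_map_eq_top {B ι : Type*} [Group B] {Q : ι → Type*} [∀ i, Group (Q i)]
    [∀ i, IsSimpleGroup (Q i)] (θ : ∀ i, B →* Q i) (hθ : ∀ i, Function.Surjective (θ i))
    (hQ : ∀ i, ⁅(⊤ : Subgroup (Q i)), (⊤ : Subgroup (Q i))⁆ = ⊤) {K : Subgroup B}
    (hK : K.Normal) {s : Set ι} (hs : s.Finite) (h : ∀ i ∈ s, K.map (θ i) = ⊤) (b : B) :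
    ∃ k ∈ K, ∃ r ∈ ⨅ i ∈ s, (θ i).ker, b = k * r := by
  induction s, hs using Set.Finite.induction_on generalizing b with
  | empty => exact ⟨1, K.one_mem, b, by simp, by simp⟩
  | @insert a s _ _ ih =>
    obtain ⟨k, hk, r, hr, rfl⟩ := ih (fun i hi => h i (Set.mem_insert_of_mem _ hi)) b
    rw [iInf_insert]
    -- If the intersection of the earlier kernels dies under `θ a`, then `r` already works;
    -- otherwise its meet with `K` maps onto `Q a`, and a factor `x` there with `θ a x = θ a r` is
    -- moved from `r` into `k`.
    rcases map_eq_bot_or_top (hθ a) _ (normal_biInf_ker θ s) with h0 | h0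
    · exact ⟨k, hk, r, ⟨(Subgroup.map_eq_bot_iff _).1 h0 hr, hr⟩, rfl⟩
    · have h1 := map_inf_eq_top (hQ a) (normal_biInf_ker θ s) hK h0
        (h a (Set.mem_insert _ _))
      obtain ⟨x, hx, hxr⟩ : θ a r ∈ Subgroup.map (θ a) _ := h1 ▸ Subgroup.mem_top (θ a r)
      refine ⟨k * x, K.mul_mem hk hx.2, x⁻¹ * r, ⟨?_, ?_⟩, by group⟩
      · simp [hxr]
      · exact Subgroup.mul_mem _ (Subgroup.inv_mem _ hx.1) hr

theorem isSimpleGroup_of_isMaximalNormal_ker {N Q : Type*} [Group N] [Group Q] {θ : N →* Q}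
    (hθ : Function.Surjective θ) (hM : IsMaximalNormal θ.ker) : IsSimpleGroup Q := by
  have : Nontrivial Q := by
    by_contra hn
    rw [not_nontrivial_iff_subsingleton] at hn
    exact hM.2.1 (eq_top_iff.2 fun n _ => Subsingleton.elim _ _)
  refine ⟨fun L hL => ?_⟩
  rcases hM.2.2 (L.comap θ) inferInstance (MonoidHom.ker_le_comap θ L) with h | h
  · left
    rw [← Subgroup.map_comap_eq_self_of_surjective hθ L, h, Subgroup.map_eq_bot_iff]
  · right
    rw [← Subgroup.map_comap_eq_self_of_surjective hθ L, h, ← MonoidHom.range_eq_map,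
      MonoidHom.range_eq_top.2 hθ]

theorem map_commutator_top {N Q : Type*} [Group N] [Group Q] {θ : N →* Q}
    (hθ : Function.Surjective θ) (hN : ⁅(⊤ : Subgroup N), (⊤ : Subgroup N)⁆ = ⊤) :
    ⁅(⊤ : Subgroup Q), (⊤ : Subgroup Q)⁆ = ⊤ := by
  have h : (⊤ : Subgroup N).map θ = ⊤ := by
    rw [← MonoidHom.range_eq_map, MonoidHom.range_eq_top.2 hθ]
  rw [← h, ← Subgroup.map_commutator, hN]

/-- A simple quotient of a finite power of a simple group `T` is isomorphic to `T`. -/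
theorem nonempty_mulEquiv_of_surjective_pi {T Q ι : Type*} [Group T] [Group Q] [IsSimpleGroup T]
    [IsSimpleGroup Q] [Finite ι] (ψ : (ι → T) →* Q) (hψ : Function.Surjective ψ) :
    Nonempty (Q ≃* T) := by
  classical
  -- The coordinate factors generate the power, so one of them survives in `Q`; it is normal, so its
  -- image is all of `Q`, and it is simple, so it embeds.
  obtain ⟨i, hi⟩ : ∃ i, ψ.comp (MonoidHom.mulSingle (fun _ => T) i) ≠ 1 := by
    by_contra! h
    have h1 : Subgroup.pi Set.univ (fun _ : ι => (⊤ : Subgroup T)) ≤ ψ.ker := by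
      refine Subgroup.pi_le_iff.2 fun i => ?_
      rintro _ ⟨t, -, rfl⟩
      exact DFunLike.congr_fun (h i) t
    obtain ⟨q, hq⟩ := exists_ne (1 : Q)
    obtain ⟨x, rfl⟩ := hψ q
    exact hq (h1 fun i _ => trivial)
  set χ := ψ.comp (MonoidHom.mulSingle (fun _ => T) i) with hχ
  have hnorm : (MonoidHom.mulSingle (fun _ : ι => T) i).range.Normal := by
    refine ⟨?_⟩
    rintro _ ⟨t, rfl⟩ g
    refine ⟨g i * t * (g i)⁻¹, ?_⟩
    ext j
    by_cases hj : j = i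
    · subst hj; simp
    · simp [hj]
  have hsurj : Function.Surjective χ := by
    rw [← MonoidHom.range_eq_top, hχ, MonoidHom.range_comp]
    rcases map_eq_bot_or_top hψ _ hnorm with h | h
    · refine absurd ?_ hi
      rw [← MonoidHom.range_comp, MonoidHom.range_eq_bot_iff] at h
      exact h
    · exact h
  have hinj : Function.Injective χ := by
    rw [← MonoidHom.ker_eq_bot_iff]
    refine (IsSimpleGroup.eq_bot_or_eq_top_of_normal χ.ker inferInstance).resolve_right fun h => ?_
    exact hi (by ext t; exact (h ▸ Subgroup.mem_top t : t ∈ χ.ker))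
  exact ⟨(MulEquiv.ofBijective χ ⟨hinj, hsurj⟩).symm⟩

/-! ### Conjugates of a quotient map of a normal subgroup. -/

variable {G : Type*} [Group G] {N : Subgroup G} [N.Normal]

/-- The composite of a homomorphism from a normal subgroup with conjugation by `g⁻¹`. -/
def twist {Q : Type*} [Group Q] (θ : N →* Q) (g : G) : N →* Q :=
  θ.comp (MulAut.conjNormal g⁻¹).toMonoidHom

theorem twist_apply {Q : Type*} [Group Q] (θ : N →* Q) (g : G) (n : N) :
    twist θ g n = θ (MulAut.conjNormal g⁻¹ n) := rfl

theorem twist_mul_apply {Q : Type*} [Group Q] (θ : N →* Q) (g h : G) (n : N) :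
    twist θ (g * h) n = twist θ h (MulAut.conjNormal g⁻¹ n) := by
  simp [twist_apply]

theorem twist_surjective {Q : Type*} [Group Q] {θ : N →* Q} (hθ : Function.Surjective θ) (g : G) :
    Function.Surjective (twist θ g) :=
  hθ.comp (MulAut.conjNormal g⁻¹).surjective

/-- Twisting by an element of `N` only composes `θ` with an inner automorphism of `Q`. Thus only the
coset of `g` modulo `N` matters. -/
theorem ker_twist_mul_coe {Q : Type*} [Group Q] (θ : N →* Q) (g : G) (m : N) :
    (twist θ (g * m)).ker = (twist θ g).ker := by
  ext n
  have : MulAut.conjNormal (m : G)⁻¹ (MulAut.conjNormal g⁻¹ n) =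
      m⁻¹ * MulAut.conjNormal g⁻¹ n * m := by
    ext; simp
  rw [MonoidHom.mem_ker, MonoidHom.mem_ker, twist_mul_apply, twist_apply, this, map_mul,
    map_mul, map_inv, twist_apply]
  simpa using conj_eq_one_iff (a := (θ m)⁻¹)

/-- The intersection of all the twisted kernels is normal in `G` and proper in `N`, so minimality
makes it trivial. -/
theorem eq_bot_of_forall_mem_ker_twist (hN : IsMinimalNormal N) {Q : Type*} [Group Q]
    [Nontrivial Q] {θ : N →* Q} (hθ : Function.Surjective θ) {n : N}
    (h : ∀ g : G, twist θ g n = 1) : n = 1 := by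
  obtain ⟨L, hLdef⟩ : ∃ L : Subgroup G, L = (⨅ g : G, (twist θ g).ker).map N.subtype := ⟨_, rfl⟩
  have hL : L.Normal := by
    rw [hLdef]
    refine ⟨?_⟩
    rintro _ ⟨x, hx, rfl⟩ g
    refine ⟨MulAut.conjNormal g x, ?_, by simp⟩
    simp only [SetLike.mem_coe, Subgroup.mem_iInf, MonoidHom.mem_ker] at hx ⊢
    intro a
    have := hx (g⁻¹ * a)
    rwa [twist_mul_apply, inv_inv] at this
  have hn : (n : G) ∈ L := hLdef ▸ ⟨n, by simpa [Subgroup.mem_iInf, MonoidHom.mem_ker] using h, rfl⟩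
  rcases hN.2.2 L hL (hLdef ▸ Subgroup.map_subtype_le _) with h0 | h0
  · rw [h0] at hn
    exact Subtype.ext hn
  · obtain ⟨q, hq⟩ := exists_ne (1 : Q)
    obtain ⟨x, rfl⟩ := hθ q
    obtain ⟨y, hy, hyx⟩ : (x : G) ∈ (⨅ g : G, (twist θ g).ker).map N.subtype := by
      rw [← hLdef, h0]
      exact x.2
    rw [show y = x from Subtype.ext hyx] at hy
    simp only [SetLike.mem_coe, Subgroup.mem_iInf, MonoidHom.mem_ker] at hy
    refine absurd ?_ hq
    simpa [twist_apply] using hy 1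

/-- The maximal normal subgroups of a perfect minimal normal subgroup are conjugate. -/
theorem exists_conj_of_isMaximalNormal [Finite G] (hN : IsMinimalNormal N)
    (hperf : ⁅(⊤ : Subgroup N), (⊤ : Subgroup N)⁆ = ⊤) {M M' : Subgroup N}
    (hM : IsMaximalNormal M) (hM' : IsMaximalNormal M') :
    ∃ g : G, ∀ n, n ∈ M ↔ MulAut.conjNormal g n ∈ M' := by
  have := hM.1
  have := hM'.1
  have := isSimpleGroup_of_isMaximalNormal_ker (QuotientGroup.mk'_surjective M)
    (by rwa [QuotientGroup.ker_mk'])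
  have := isSimpleGroup_of_isMaximalNormal_ker (QuotientGroup.mk'_surjective M')
    (by rwa [QuotientGroup.ker_mk'])
  -- Otherwise every conjugate of `M` maps onto the perfect simple group `N ⧸ M'`, hence so does
  -- their intersection, which is trivial.
  obtain ⟨g, hg⟩ : ∃ g : G, (twist (QuotientGroup.mk' M) g).ker ≤ M' := by
    by_contra! h
    have h1 := map_biInf_ker_eq_top (fun g : G => twist (QuotientGroup.mk' M) g)
      (QuotientGroup.mk'_surjective M')
      (map_commutator_top (QuotientGroup.mk'_surjective M') hperf) (Set.toFinite Set.univ)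
      (fun g _ => (map_eq_bot_or_top (QuotientGroup.mk'_surjective M') _ inferInstance).resolve_left
        (fun h0 => h g (by rwa [Subgroup.map_eq_bot_iff, QuotientGroup.ker_mk'] at h0)))
    have h2 : (⨅ g ∈ (Set.univ : Set G), (twist (QuotientGroup.mk' M) g).ker) = ⊥ := by
      rw [eq_bot_iff]
      intro n hn
      simp only [Subgroup.mem_iInf, MonoidHom.mem_ker] at hn
      exact eq_bot_of_forall_mem_ker_twist hN (QuotientGroup.mk'_surjective M)
        fun g => hn g trivial
    rw [h2, Subgroup.map_bot] at h1
    exact bot_ne_top h1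
  refine ⟨g, fun n => ?_⟩
  have hL : M'.comap (MulAut.conjNormal g).toMonoidHom = M := by
    refine (hM.2.2 _ inferInstance fun n hn => ?_).resolve_right fun h => hM'.2.1 ?_
    · refine hg ?_
      rw [MonoidHom.mem_ker, twist_apply]
      simpa using hn
    · rw [eq_top_iff]
      intro n _
      have : MulAut.conjNormal g⁻¹ n ∈ M'.comap (MulAut.conjNormal g).toMonoidHom := by
        rw [h]; trivial
      simpa using this
  conv_lhs => rw [← hL]
  rfl

end Groups

/-! ### Bounds on vertex stabilisers from local data. -/

section Graphs

variable {V : Type*} {Γ : SimpleGraph V}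

theorem SimpleGraph.Connected.forall_of_adj (hconn : Γ.Connected) {p : V → Prop} {a : V} (ha : p a)
    (hp : ∀ b c, Γ.Adj b c → p b → p c) (v : V) : p v := by
  have h := (SimpleGraph.reachable_iff_reflTransGen a v).1 (hconn.preconnected a v)
  induction h with
  | refl => exact ha
  | tail _ hbc ih => exact hp _ _ hbc ih

/-- A set of automorphisms of a connected graph that moves a vertex to each of its neighbours
generates a transitive group. -/
theorem exists_mem_closure_smul_eq {K : Type*} [Group K] [MulAction K V]
    (hadj : ∀ (g : K) a b, Γ.Adj (g • a) (g • b) ↔ Γ.Adj a b) (hconn : Γ.Connected) {a : V}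
    {X : Set K} (hX : ∀ b, Γ.Adj a b → ∃ x ∈ X, x • a = b) (v : V) :
    ∃ h ∈ Subgroup.closure X, h • a = v := by
  refine hconn.forall_of_adj (p := fun v => ∃ h ∈ Subgroup.closure X, h • a = v)
    (a := a) ⟨1, Subgroup.one_mem _, one_smul _ _⟩ ?_ v
  rintro _ c hbc ⟨h, hh, rfl⟩
  have : Γ.Adj a (h⁻¹ • c) := by rwa [← hadj h, smul_inv_smul]
  obtain ⟨x, hx, hxa⟩ := hX _ this
  exact ⟨h * x, Subgroup.mul_mem _ hh (Subgroup.subset_closure hx), by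
    rw [mul_smul, hxa, smul_inv_smul]⟩

variable {G : Type*} [Group G] [MulAction G V] {N : Subgroup G} [N.Normal]

theorem conjNormal_smul (g : G) (n : N) (v : V) :
    MulAut.conjNormal g n • v = g • n • g⁻¹ • v := by
  simp [Subgroup.smul_def, MulAut.conjNormal_apply, mul_smul]

/-- The order of a vertex stabiliser is bounded in terms of the order of the vertex stabiliser in a
transitive normal subgroup. -/
theorem card_stabilizer_le_of_normal [Finite V] [Finite G] [FaithfulSMul G V]
    [MulAction.IsPretransitive N V]
    (hadj : ∀ (g : G) a b, Γ.Adj (g • a) (g • b) ↔ Γ.Adj a b) (hconn : Γ.Connected) {d : ℕ} {a : V}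
    (hd : (Γ.neighborSet a).ncard ≤ d) :
    Nat.card (MulAction.stabilizer G a) ≤ (d * Nat.card (MulAction.stabilizer N a))! := by
  have htr : ∀ v : V, ∃ n : N, n • a = v := MulAction.exists_smul_eq N a
  choose ν hν using htr
  -- `X` is a union of at most `d` cosets of `N_a`, is preserved by conjugation by `G_a`, and
  -- generates a transitive group; an element of `G_a` centralising it fixes every vertex.
  let X : Set N := {n | Γ.Adj a (n • a)}
  have hXcard : Nat.card X ≤ d * Nat.card (MulAction.stabilizer N a) := by
    let f : X → Γ.neighborSet a × MulAction.stabilizer N a := fun n =>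
      (⟨n.1 • a, n.2⟩, ⟨(ν (n.1 • a))⁻¹ * n.1, by
        rw [MulAction.mem_stabilizer_iff, mul_smul, inv_smul_eq_iff, hν]⟩)
    have hf : Function.Injective f := by
      intro m n h
      simp only [f, Prod.mk.injEq, Subtype.mk.injEq] at h
      obtain ⟨h1, h2⟩ := h
      rw [show m.1 • a = n.1 • a from congrArg Subtype.val h1] at h2
      exact Subtype.ext (mul_left_cancel h2)
    refine (Nat.card_le_card_of_injective f hf).trans ?_
    rw [Nat.card_prod]
    exact Nat.mul_le_mul_right _ hd
  have hconj : ∀ g ∈ MulAction.stabilizer G a, ∀ n : N,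
      n ∈ X ↔ MulAut.conjNormal g n ∈ X := by
    intro g hg n
    have hg' : g⁻¹ • a = a := by rw [inv_smul_eq_iff]; exact hg.symm
    change Γ.Adj a (n • a) ↔ Γ.Adj a (MulAut.conjNormal g n • a)
    rw [conjNormal_smul, hg', ← hadj g a, MulAction.mem_stabilizer_iff.1 hg]
  let F : MulAction.stabilizer G a → Equiv.Perm X := fun g =>
    (MulAut.conjNormal (g : G)).toEquiv.subtypeEquiv fun n => hconj g g.2 n
  have hF : Function.Injective F := by
    intro g h hgh
    have hX : ∀ n ∈ X, MulAut.conjNormal (g : G) n = MulAut.conjNormal (h : G) n := fun n hn =>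
      congrArg Subtype.val (DFunLike.congr_fun hgh (⟨n, hn⟩ : X))
    have hcl : ∀ n ∈ Subgroup.closure X,
        (MulAut.conjNormal (g : G)).toMonoidHom n = (MulAut.conjNormal (h : G)).toMonoidHom n :=
      fun n hn => MonoidHom.eqOn_closure
        (f := (MulAut.conjNormal (g : G) : N ≃* N).toMonoidHom)
        (g := (MulAut.conjNormal (h : G) : N ≃* N).toMonoidHom) hX hn
    apply Subtype.ext
    apply FaithfulSMul.eq_of_smul_eq_smul (α := V)
    intro v
    obtain ⟨n, hn, rfl⟩ := exists_mem_closure_smul_eq (K := N) (fun n => hadj n) hconn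
      (X := X) (fun b hb => ⟨ν b, by simpa [X, hν] using hb, hν b⟩) v
    have h1 : MulAut.conjNormal (g : G) n • a = MulAut.conjNormal (h : G) n • a := by
      rw [show MulAut.conjNormal (g : G) n = MulAut.conjNormal (h : G) n from hcl n hn]
    have hg' : ∀ g : MulAction.stabilizer G a, (g : G)⁻¹ • a = a := fun g => by
      rw [inv_smul_eq_iff]; exact g.2.symm
    rwa [conjNormal_smul, conjNormal_smul, hg', hg'] at h1
  calc Nat.card (MulAction.stabilizer G a) ≤ Nat.card (Equiv.Perm X) :=
        Nat.card_le_card_of_injective F hF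
    _ = (Nat.card X)! := Nat.card_perm
    _ ≤ _ := Nat.factorial_le hXcard

/-- The pointwise stabiliser of a closed neighbourhood. -/
def ballStabilizer (Γ : SimpleGraph V) (N : Type*) [Group N] [MulAction N V] (v : V) :
    Subgroup N where
  carrier := {n | n • v = v ∧ ∀ b, Γ.Adj v b → n • b = b}
  one_mem' := by simp
  mul_mem' := by
    rintro m n ⟨hm, hm'⟩ ⟨hn, hn'⟩
    exact ⟨by rw [mul_smul, hn, hm], fun b hb => by rw [mul_smul, hn' b hb, hm' b hb]⟩
  inv_mem' := by
    rintro n ⟨hn, hn'⟩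
    exact ⟨by rw [inv_smul_eq_iff, hn], fun b hb => by rw [inv_smul_eq_iff, hn' b hb]⟩

theorem conj_mem_ballStabilizer {N : Type*} [Group N] [MulAction N V]
    (hadj : ∀ (g : N) a b, Γ.Adj (g • a) (g • b) ↔ Γ.Adj a b) {n x : N} {v : V}
    (hx : n⁻¹ * x * n ∈ ballStabilizer Γ N v) : x ∈ ballStabilizer Γ N (n • v) := by
  obtain ⟨h1, h2⟩ := hx
  refine ⟨by rwa [mul_smul, mul_smul, inv_smul_eq_iff] at h1, fun b hb => ?_⟩
  have := h2 (n⁻¹ • b) (by rwa [← hadj n, smul_inv_smul])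
  rwa [mul_smul, mul_smul, smul_inv_smul, smul_left_cancel_iff] at this

theorem card_stabilizer_le_factorial_of_ballStabilizer {N : Type*} [Group N] [MulAction N V]
    [Finite V] (hadj : ∀ (g : N) a b, Γ.Adj (g • a) (g • b) ↔ Γ.Adj a b) {d : ℕ} {a : V}
    (hd : (Γ.neighborSet a).ncard ≤ d) (h : ballStabilizer Γ N a = ⊥) :
    Nat.card (MulAction.stabilizer N a) ≤ d ! := by
  have hst : ∀ g ∈ MulAction.stabilizer N a, ∀ b, b ∈ Γ.neighborSet a ↔
      MulAction.toPerm g b ∈ Γ.neighborSet a := by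
    intro g hg b
    rw [MulAction.toPerm_apply, SimpleGraph.mem_neighborSet, SimpleGraph.mem_neighborSet,
      ← hadj g a b, MulAction.mem_stabilizer_iff.1 hg]
  let F : MulAction.stabilizer N a → Equiv.Perm (Γ.neighborSet a) := fun g =>
    (MulAction.toPerm (g : N)).subtypeEquiv (hst g g.2)
  have hF : Function.Injective F := by
    intro g k hgk
    have hb : ∀ b, Γ.Adj a b → (g : N) • b = (k : N) • b := fun b hb =>
      congrArg Subtype.val (DFunLike.congr_fun hgk (⟨b, hb⟩ : Γ.neighborSet a))
    have : (k : N)⁻¹ * g ∈ ballStabilizer Γ N a := by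
      refine ⟨?_, fun b hab => ?_⟩
      · rw [mul_smul, MulAction.mem_stabilizer_iff.1 g.2, inv_smul_eq_iff]
        exact k.2.symm
      · rw [mul_smul, hb b hab, inv_smul_smul]
    rw [h, Subgroup.mem_bot, inv_mul_eq_one] at this
    exact Subtype.ext this.symm
  calc Nat.card (MulAction.stabilizer N a) ≤ Nat.card (Equiv.Perm (Γ.neighborSet a)) :=
        Nat.card_le_card_of_injective F hF
    _ = (Nat.card (Γ.neighborSet a))! := Nat.card_perm
    _ ≤ d ! := Nat.factorial_le hd

/-- If the vertex stabilisers in a transitive normal subgroup `N` map onto all the conjugates of a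
perfect simple quotient of `N`, then they act faithfully on the neighbourhoods. -/
theorem ballStabilizer_eq_bot [Finite G] [FaithfulSMul G V] [MulAction.IsPretransitive N V]
    (hadj : ∀ (g : G) a b, Γ.Adj (g • a) (g • b) ↔ Γ.Adj a b) (hconn : Γ.Connected)
    {Q : Type*} [Group Q] [IsSimpleGroup Q] {θ : N →* Q}
    (hQ : ⁅(⊤ : Subgroup Q), (⊤ : Subgroup Q)⁆ = ⊤)
    (hN : ∀ n : N, (∀ g : G, twist θ g n = 1) → n = 1)
    (hsurj : ∀ (v : V) (q : Q), ∃ n : N, n • v = v ∧ θ n = q) (a : V) :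
    ballStabilizer Γ N a = ⊥ := by
  have hstep : ∀ v w, Γ.Adj v w → ballStabilizer Γ N v ≤ ballStabilizer Γ N w := by
    intro v w hvw
    let J : Set G := {g | ∃ k ∈ ballStabilizer Γ N v, twist θ g k ≠ 1}
    have hJ : ∀ g ∉ J, ∀ k ∈ ballStabilizer Γ N v, twist θ g k = 1 := by
      intro g hg k hk
      by_contra h
      exact hg ⟨k, hk, h⟩
    -- The local kernel at `v` maps onto `Q` at each twist in `J`, so `n = k * r` with `k` in it and
    -- `r` trivial on `J`. Outside `J` both `n` and `k` are trivial, so `r = 1`.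
    have hkey : ∀ n : N, n • v = v → (∀ g ∉ J, twist θ g n = 1) → n ∈ ballStabilizer Γ N v := by
      intro n hnv hn
      have hs : ∀ g : G, Function.Surjective
          ((twist θ g).comp (MulAction.stabilizer N v).subtype) := by
        intro g q
        obtain ⟨m, hm, rfl⟩ := hsurj (g⁻¹ • v) q
        refine ⟨⟨MulAut.conjNormal g m, ?_⟩, ?_⟩
        · rw [MulAction.mem_stabilizer_iff, conjNormal_smul, hm, smul_inv_smul]
        · simp [twist_apply]
      have hK : ((ballStabilizer Γ N v).subgroupOf (MulAction.stabilizer N v)).Normal := by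
        refine ⟨fun k hk g => ?_⟩
        rw [Subgroup.mem_subgroupOf] at hk ⊢
        have := conj_mem_ballStabilizer (fun n : N => hadj n) (n := (g : N))
          (x := (g : N) * k * (g : N)⁻¹) (v := v) (by simpa [mul_assoc] using hk)
        rwa [MulAction.mem_stabilizer_iff.1 g.2] at this
      obtain ⟨k, hk, r, hr, hkr⟩ := exists_mul_of_map_eq_top
        (fun g : G => (twist θ g).comp (MulAction.stabilizer N v).subtype) hs (fun _ => hQ) hK
        (Set.toFinite J) (by
          rintro g ⟨k, hk, hk1⟩
          refine (map_eq_bot_or_top (hs g) _ hK).resolve_left fun h => hk1 ?_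
          rw [Subgroup.map_eq_bot_iff] at h
          exact h (x := ⟨k, hk.1⟩) hk) ⟨n, hnv⟩
      have hkr' : n = k * r := congrArg Subtype.val hkr
      have hr1 : (r : N) = 1 := by
        refine hN _ fun g => ?_
        by_cases hg : g ∈ J
        · simp only [Subgroup.mem_iInf] at hr
          exact hr g hg
        · have h1 := hn g hg
          rwa [hkr', map_mul, hJ g hg k hk, one_mul] at h1
      rw [hkr', hr1, mul_one]
      exact hk
    intro x hx
    obtain ⟨n, rfl⟩ := MulAction.exists_smul_eq N v w
    -- `x` fixes the neighbour `n • v`, so its conjugate `n⁻¹ * x * n` fixes `v`; being trivial at a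
    -- twist is invariant under conjugation in `N`, so `hkey` applies.
    refine conj_mem_ballStabilizer (fun n : N => hadj n) (hkey _ ?_ fun g hg => ?_)
    · rw [mul_smul, mul_smul, hx.2 _ hvw, inv_smul_smul]
    · rw [map_mul, map_mul, hJ g hg x hx, map_inv, mul_one, inv_mul_cancel]
  rw [eq_bot_iff]
  intro n hn
  have hall := hconn.forall_of_adj (p := fun v => n ∈ ballStabilizer Γ N v) hn
    fun b c hbc hb => hstep b c hbc hb
  rw [Subgroup.mem_bot]
  apply Subtype.ext
  apply FaithfulSMul.eq_of_smul_eq_smul (α := V)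
  intro v
  rw [Subgroup.coe_one, one_smul]
  exact (hall v).1

/-- If the vertex stabiliser in a transitive normal subgroup `N` does not map onto a simple quotient
of `N`, then its order is bounded in terms of the order of its image. -/
theorem card_stabilizer_le_pow [Finite V] [Finite G] [MulAction.IsPretransitive N V]
    (hadj : ∀ (g : G) a b, Γ.Adj (g • a) (g • b) ↔ Γ.Adj a b) (hconn : Γ.Connected) {d r : ℕ}
    (hd0 : 0 < d) {a : V} (hd : (Γ.neighborSet a).ncard ≤ d)
    {Q : Type*} [Group Q] [IsSimpleGroup Q] {θ : N →* Q} (hθ : Function.Surjective θ)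
    (hN : ∀ n : N, (∀ g : G, twist θ g n = 1) → n = 1)
    (hR : (MulAction.stabilizer N a).map θ ≠ ⊤)
    (hr : Nat.card ((MulAction.stabilizer N a).map θ) ≤ r) :
    Nat.card (MulAction.stabilizer N a) ≤ r ^ ((d * r) ^ d) := by
  have : Finite Q := Finite.of_surjective θ hθ
  choose ν hν using MulAction.exists_smul_eq N a
  set R := (MulAction.stabilizer N a).map θ with hRdef
  have hr0 : 0 < r := Nat.card_pos.trans_le hr
  have hmemR : ∀ h ∈ MulAction.stabilizer G a, ∀ n ∈ MulAction.stabilizer N a,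
      twist θ h n ∈ R := by
    intro h hh n hn
    refine ⟨MulAut.conjNormal h⁻¹ n, ?_, rfl⟩
    rw [SetLike.mem_coe, MulAction.mem_stabilizer_iff, conjNormal_smul, inv_inv,
      MulAction.mem_stabilizer_iff.1 hh, MulAction.mem_stabilizer_iff.1 hn, inv_smul_eq_iff]
    exact hh.symm
  -- For `h ∈ G_a`, the element `h⁻¹ (ν b) h` moves `a` to the neighbour `h⁻¹ • b`, so it lies in `ν
  -- (h⁻¹ • b) N_a` and its image lies in `U`.
  let U : Set Q := Set.range fun p : Γ.neighborSet a × R => θ (ν p.1) * p.2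
  have hU : Nat.card U ≤ d * r := by
    refine (Finite.card_range_le _).trans ?_
    rw [Nat.card_prod]
    exact Nat.mul_le_mul hd hr
  let F : MulAction.stabilizer G a → Γ.neighborSet a → U := fun h b =>
    ⟨twist θ (h : G) (ν b), by
      have hh := MulAction.mem_stabilizer_iff.1 h.2
      have hb : Γ.Adj a ((h : G)⁻¹ • (b : V)) := by
        rw [← hadj (h : G), smul_inv_smul, hh]
        exact b.2
      refine ⟨(⟨_, hb⟩, ⟨θ ((ν ((h : G)⁻¹ • (b : V)))⁻¹ * MulAut.conjNormal (h : G)⁻¹ (ν b)),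
        ⟨_, ?_, rfl⟩⟩), ?_⟩
      · rw [SetLike.mem_coe, MulAction.mem_stabilizer_iff, mul_smul, conjNormal_smul, inv_inv, hh,
          hν, inv_smul_eq_iff, hν]
      · simp [twist_apply]⟩
  -- The two twists agree on the transitive group generated by the `ν b`, which supplements `N_a`.
  -- So the second maps the kernel of the first into `R`; that image is normal and `R` is proper, so
  -- it is trivial.
  have hFle : ∀ h k, F h = F k → (twist θ (h : G)).ker ≤ (twist θ (k : G)).ker := by
    intro h k hhk
    have hν' : ∀ b, Γ.Adj a b → twist θ (h : G) (ν b) = twist θ (k : G) (ν b) := fun b hb =>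
      congrArg Subtype.val (congrFun hhk ⟨b, hb⟩)
    have hcl : ∀ n ∈ Subgroup.closure (ν '' Γ.neighborSet a),
        twist θ (h : G) n = twist θ (k : G) n := by
      refine fun n hn => MonoidHom.eqOn_closure ?_ hn
      rintro _ ⟨b, hb, rfl⟩
      exact hν' b hb
    rw [← Subgroup.map_eq_bot_iff]
    refine (map_eq_bot_or_top (twist_surjective hθ (k : G)) _ inferInstance).resolve_right
      fun htop => hR (top_le_iff.1 (htop ▸ ?_))
    rintro _ ⟨n, hn, rfl⟩
    obtain ⟨m, hm, hmn⟩ := exists_mem_closure_smul_eq (K := N) (fun n => hadj n) hconn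
      (X := ν '' Γ.neighborSet a) (fun b hb => ⟨ν b, ⟨b, hb, rfl⟩, hν b⟩) (n • a)
    have hx : m⁻¹ * n ∈ MulAction.stabilizer N a := by
      rw [MulAction.mem_stabilizer_iff, mul_smul, ← hmn, inv_smul_smul]
    have h1 := R.mul_mem (R.inv_mem (hmemR h h.2 _ hx)) (hmemR k k.2 _ hx)
    rwa [map_mul, map_mul, map_inv, map_inv, hcl m hm, show twist θ (h : G) n = 1 from hn,
      mul_one, inv_inv, mul_inv_cancel_left] at h1
  choose σ hσ using fun c : Set.range F => c.2
  let E : MulAction.stabilizer N a → Set.range F → R := fun n c =>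
    ⟨twist θ (σ c : G) n, hmemR _ (σ c).2 _ n.2⟩
  have hE : Function.Injective E := by
    intro m n hmn
    have h1 : ∀ h : MulAction.stabilizer G a, twist θ (h : G) ((m : N)⁻¹ * n) = 1 := by
      intro h
      refine hFle (σ ⟨F h, h, rfl⟩) h (hσ _) ?_
      have := congrArg Subtype.val (congrFun hmn ⟨F h, h, rfl⟩)
      rw [MonoidHom.mem_ker, map_mul, map_inv, inv_mul_eq_one]
      exact this
    apply Subtype.ext
    rw [← inv_mul_eq_one]
    refine hN _ fun g => ?_
    -- As `N` is transitive, `g` can be corrected by an element of `N` to fix `a` without changing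
    -- the twisted kernel.
    have hx : (g * (((ν (g⁻¹ • a)) : N) : G)) ∈ MulAction.stabilizer G a := by
      rw [MulAction.mem_stabilizer_iff, mul_smul, ← Subgroup.smul_def, hν, smul_inv_smul]
    have := h1 ⟨_, hx⟩
    rwa [← MonoidHom.mem_ker, ker_twist_mul_coe, MonoidHom.mem_ker] at this
  have hFcard : Nat.card (Set.range F) ≤ (d * r) ^ d := by
    refine (Nat.card_le_card_of_injective _ Subtype.val_injective).trans ?_
    rw [Nat.card_fun]
    exact (Nat.pow_le_pow_left hU _).trans (Nat.pow_le_pow_right (Nat.mul_pos hd0 hr0) hd)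
  refine (Nat.card_le_card_of_injective E hE).trans ?_
  rw [Nat.card_fun]
  exact (Nat.pow_le_pow_left hr _).trans (Nat.pow_le_pow_right hr0 hFcard)

end Graphs

/-! ### Isomorphisms of pairs and transport of the socle. -/

section Pairs

theorem PairIso.refl {V : Type*} (Γ : SimpleGraph V) (G : Subgroup (Equiv.Perm V)) :
    PairIso Γ G Γ G :=
  ⟨Equiv.refl V, fun _ _ => Iff.rfl, fun _ => Iff.rfl⟩

theorem PairIso.trans {V W X : Type*} {Γ : SimpleGraph V} {G : Subgroup (Equiv.Perm V)}
    {Λ : SimpleGraph W} {H : Subgroup (Equiv.Perm W)} {Δ : SimpleGraph X}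
    {K : Subgroup (Equiv.Perm X)} (h₁ : PairIso Γ G Λ H) (h₂ : PairIso Λ H Δ K) :
    PairIso Γ G Δ K := by
  obtain ⟨e, he, he'⟩ := h₁
  obtain ⟨f, hf, hf'⟩ := h₂
  exact ⟨e.trans f, fun a b => (hf _ _).trans (he a b), fun g => (he' g).trans (hf' _)⟩

/-- Equivalent actions on isomorphic graphs induce isomorphic quotient pairs. -/
theorem pairIso_quotient {V V' N N' : Type*} [Group N] [Group N'] [MulAction N V]
    [MulAction N' V'] {Γ : SimpleGraph V} {Γ' : SimpleGraph V'} (e : V ≃ V')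
    (he : ∀ a b, Γ'.Adj (e a) (e b) ↔ Γ.Adj a b) (τ : N ≃* N')
    (hτ : ∀ (n : N) v, e (n • v) = τ n • e v) {M : Subgroup N} {M' : Subgroup N'}
    (hM : ∀ n, n ∈ M ↔ τ n ∈ M') :
    PairIso (quotientGraph Γ M) (inducedGroup V M) (quotientGraph Γ' M') (inducedGroup V' M') := by
  have horb : ∀ a b : V, MulAction.orbitRel M V a b ↔ MulAction.orbitRel M' V' (e a) (e b) := by
    intro a b
    rw [MulAction.orbitRel_apply, MulAction.orbitRel_apply]
    constructor
    · rintro ⟨m, rfl⟩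
      exact ⟨⟨τ m, (hM m).1 m.2⟩, (hτ m b).symm⟩
    · rintro ⟨m, hm⟩
      refine ⟨⟨τ.symm m, (hM _).2 (by simp)⟩, e.injective ?_⟩
      change e (τ.symm (m : N') • b) = e a
      rw [hτ, τ.apply_symm_apply]
      exact hm
  let q : MulAction.orbitRel.Quotient M V ≃ MulAction.orbitRel.Quotient M' V' :=
    Quotient.congr e horb
  have hq : ∀ v : V, q (Quotient.mk _ v) = Quotient.mk _ (e v) := fun v => rfl
  refine ⟨q, fun x y => ?_, fun p => ?_⟩
  · constructor
    · rintro ⟨hne, a, b, ha, hb, hab⟩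
      refine ⟨fun h => hne (h ▸ rfl), e.symm a, e.symm b, q.injective ?_, q.injective ?_, ?_⟩
      · rw [hq, e.apply_symm_apply, ha]
      · rw [hq, e.apply_symm_apply, hb]
      · rwa [← he, e.apply_symm_apply, e.apply_symm_apply]
    · rintro ⟨hne, a, b, rfl, rfl, hab⟩
      exact ⟨fun h => hne (q.injective h), e a, e b, (hq a).symm, (hq b).symm, (he a b).2 hab⟩
  · constructor
    · rintro ⟨n, hn⟩
      refine ⟨τ n, fun v => ?_⟩
      rw [Equiv.permCongr_apply, show q.symm (Quotient.mk _ v) = Quotient.mk _ (e.symm v) from rfl,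
        hn, hq, hτ, e.apply_symm_apply]
    · rintro ⟨n, hn⟩
      refine ⟨τ.symm n, fun v => q.injective ?_⟩
      have := hn (e v)
      rw [Equiv.permCongr_apply, ← hq, q.symm_apply_apply] at this
      rw [this, hq, hτ, τ.apply_symm_apply]

theorem IsMinimalNormal.map {G G' : Type*} [Group G] [Group G'] (χ : G ≃* G') {K : Subgroup G}
    (hK : IsMinimalNormal K) : IsMinimalNormal (K.map χ.toMonoidHom) := by
  refine ⟨hK.1.map _ χ.surjective, fun h => hK.2.1 ?_, fun L hL hLK => ?_⟩
  · exact (Subgroup.map_eq_bot_iff_of_injective _ χ.injective).1 h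
  · have h1 : L.comap χ.toMonoidHom ≤ K := by
      rw [← Subgroup.comap_map_eq_self_of_injective (f := χ.toMonoidHom) χ.injective K]
      exact Subgroup.comap_mono hLK
    rw [← Subgroup.map_comap_eq_self_of_surjective (f := χ.toMonoidHom) χ.surjective L]
    rcases hK.2.2 _ (hL.comap _) h1 with h | h
    · left; rw [h, Subgroup.map_bot]
    · right; rw [h]

theorem socle_map_le {G G' : Type*} [Group G] [Group G'] (χ : G ≃* G') :
    (socle G).map χ.toMonoidHom ≤ socle G' := by
  rw [Subgroup.map_le_iff_le_comap]
  refine sSup_le fun K hK => ?_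
  rw [← Subgroup.map_le_iff_le_comap]
  exact le_sSup (IsMinimalNormal.map χ hK)

theorem socle_map {G G' : Type*} [Group G] [Group G'] (χ : G ≃* G') :
    (socle G).map χ.toMonoidHom = socle G' := by
  refine le_antisymm (socle_map_le χ) fun x hx => ⟨χ.symm x, ?_, χ.apply_symm_apply x⟩
  exact socle_map_le χ.symm ⟨x, hx, rfl⟩

theorem IsMaximalNormal.comap {N N' : Type*} [Group N] [Group N'] (τ : N ≃* N') {M : Subgroup N'}
    (hM : IsMaximalNormal M) : IsMaximalNormal (M.comap τ.toMonoidHom) := by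
  refine ⟨hM.1.comap _, fun h => hM.2.1 ?_, fun L hL hLM => ?_⟩
  · rw [← Subgroup.map_comap_eq_self_of_surjective (f := τ.toMonoidHom) τ.surjective M, h,
      ← MonoidHom.range_eq_map, MonoidHom.range_eq_top.2 τ.surjective]
  · have h1 : M ≤ L.map τ.toMonoidHom := by
      rw [← Subgroup.map_comap_eq_self_of_surjective (f := τ.toMonoidHom) τ.surjective M]
      exact Subgroup.map_mono hLM
    rw [← Subgroup.comap_map_eq_self_of_injective (f := τ.toMonoidHom) τ.injective L]
    rcases hM.2.2 _ (hL.map _ τ.surjective) h1 with h | h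
    · left; rw [h]
    · right; rw [h, Subgroup.comap_top]

/-- An isomorphism of pairs carries the action of one socle to the action of the other. -/
theorem PairIso.exists_socle_equiv {V V' : Type*} {Γ : SimpleGraph V} {G : Subgroup (Equiv.Perm V)}
    {Γ' : SimpleGraph V'} {G' : Subgroup (Equiv.Perm V')} (h : PairIso Γ G Γ' G') :
    ∃ (e : V ≃ V') (τ : socle G ≃* socle G'), (∀ a b, Γ'.Adj (e a) (e b) ↔ Γ.Adj a b) ∧
      ∀ (n : socle G) v, e (n • v) = τ n • e v := by
  obtain ⟨e, he, hG⟩ := h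
  have hmap : G.map e.permCongrHom.toMonoidHom = G' := by
    ext p
    constructor
    · rintro ⟨g, hg, rfl⟩
      exact (hG g).1 hg
    · intro hp
      refine ⟨e.symm.permCongr p, (hG _).2 ?_, ?_⟩
      · convert hp
        ext v
        simp
      · ext v
        simp
  let χ : G ≃* G' := (e.permCongrHom.subgroupMap G).trans (MulEquiv.subgroupCongr hmap)
  refine ⟨e, (χ.subgroupMap (socle G)).trans (MulEquiv.subgroupCongr (socle_map χ)), he,
    fun n v => ?_⟩
  change e (((n : G) : Equiv.Perm V) v) = e (((n : G) : Equiv.Perm V) (e.symm (e v)))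
  rw [e.symm_apply_apply]

/-! ### The action on the orbits of a normal subgroup. -/

variable {V N : Type*} [Group N] [MulAction N V] (M : Subgroup N) [M.Normal]

theorem orbitRel_smul_iff (n : N) (a b : V) :
    MulAction.orbitRel M V a b ↔ MulAction.orbitRel M V (n • a) (n • b) := by
  rw [MulAction.orbitRel_apply, MulAction.orbitRel_apply]
  have hM : M.Normal := inferInstance
  constructor
  · rintro ⟨m, rfl⟩
    refine ⟨⟨n * m * n⁻¹, hM.conj_mem _ m.2 n⟩, ?_⟩
    simp [Subgroup.smul_def, mul_smul]
  · rintro ⟨m, hm⟩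
    refine ⟨⟨n⁻¹ * m * n, by simpa using hM.conj_mem _ m.2 n⁻¹⟩, ?_⟩
    change (n⁻¹ * (m : N) * n) • b = a
    rw [mul_smul, mul_smul, inv_smul_eq_iff]
    exact hm

/-- The homomorphism from `N` onto the group that it induces on the orbits of `M`. -/
def inducedHom (V : Type*) {N : Type*} [Group N] [MulAction N V] (M : Subgroup N) [M.Normal] :
    N →* inducedGroup V M where
  toFun n := ⟨Quotient.congr (MulAction.toPerm n) (orbitRel_smul_iff M n), n, fun _ => rfl⟩
  map_one' := by
    apply Subtype.ext
    ext x
    induction x using Quotient.inductionOn with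
    | h v => exact congrArg (Quotient.mk _) (one_smul N v)
  map_mul' m n := by
    apply Subtype.ext
    ext x
    induction x using Quotient.inductionOn with
    | h v => exact congrArg (Quotient.mk _) (mul_smul m n v)

theorem inducedHom_apply_mk (n : N) (v : V) :
    (inducedHom V M n : Equiv.Perm (MulAction.orbitRel.Quotient M V)) (Quotient.mk _ v) =
      Quotient.mk _ (n • v) := rfl

theorem inducedHom_surjective : Function.Surjective (inducedHom V M) := by
  rintro ⟨p, n, hn⟩
  refine ⟨n, Subtype.ext ?_⟩
  ext x
  induction x using Quotient.inductionOn with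
  | h v => exact (hn v).symm

theorem le_ker_inducedHom : M ≤ (inducedHom V M).ker := by
  intro m hm
  rw [MonoidHom.mem_ker]
  apply Subtype.ext
  ext x
  induction x using Quotient.inductionOn with
  | h v => exact Quotient.sound (s := MulAction.orbitRel M V) ⟨⟨m, hm⟩, rfl⟩

/-- By maximality the kernel is `M` or `N`; in the latter case the transitive group `N` fixes every
`M`-orbit, so there is only one. -/
theorem ker_inducedHom [MulAction.IsPretransitive N V] (hM : IsMaximalNormal M)
    (hint : ¬ MulAction.IsPretransitive M V) : (inducedHom V M).ker = M := by
  refine (hM.2.2 _ inferInstance (le_ker_inducedHom M)).resolve_right fun h => hint ⟨fun a b => ?_⟩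
  obtain ⟨n, rfl⟩ := MulAction.exists_smul_eq N b a
  have hn : inducedHom V M n = 1 := (h ▸ Subgroup.mem_top n : n ∈ (inducedHom V M).ker)
  have h1 := inducedHom_apply_mk M n b
  rw [hn] at h1
  exact Quotient.exact (s := MulAction.orbitRel M V) h1

/-- An element of `N` preserving the `M`-orbit of `a` can be corrected by an element of `M` to fix
`a`. -/
theorem stabilizer_inducedGroup (a : V) :
    MulAction.stabilizer (inducedGroup V M)
      (Quotient.mk _ a : MulAction.orbitRel.Quotient M V) =
      (MulAction.stabilizer N a).map (inducedHom V M) := by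
  ext p
  constructor
  · intro hp
    obtain ⟨n, rfl⟩ := inducedHom_surjective M p
    obtain ⟨m, hm⟩ := Quotient.exact (s := MulAction.orbitRel M V)
      (MulAction.mem_stabilizer_iff.1 hp)
    refine ⟨(m : N)⁻¹ * n, ?_, ?_⟩
    · rw [SetLike.mem_coe, MulAction.mem_stabilizer_iff, mul_smul, inv_smul_eq_iff]
      exact hm.symm
    · rw [map_mul, map_inv, (le_ker_inducedHom M m.2 : inducedHom V M (m : N) = 1), inv_one,
        one_mul]
  · rintro ⟨n, hn, rfl⟩
    exact congrArg (Quotient.mk _) (MulAction.mem_stabilizer_iff.1 hn)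

theorem inFamily_quotient [Finite V] [MulAction.IsPretransitive N V] {Γ : SimpleGraph V} {d : ℕ}
    (hadj : ∀ (n : N) a b, Γ.Adj (n • a) (n • b) ↔ Γ.Adj a b) (hconn : Γ.Connected)
    (hd : ∀ v, (Γ.neighborSet v).ncard ≤ d) :
    InFamily d (quotientGraph Γ M) (inducedGroup V M) where
  le_aut := by
    have h1 : ∀ p ∈ inducedGroup V M, ∀ x y,
        (quotientGraph Γ M).Adj x y → (quotientGraph Γ M).Adj (p x) (p y) := by
      rintro p ⟨n, hn⟩ _ _ ⟨hne, a, b, rfl, rfl, hab⟩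
      exact ⟨fun h => hne (p.injective h), n • a, n • b, (hn a).symm, (hn b).symm,
        (hadj n a b).2 hab⟩
    intro p hp x y
    refine ⟨fun h => ?_, h1 p hp x y⟩
    simpa using h1 p⁻¹ (inv_mem hp) _ _ h
  transitive := by
    refine ⟨fun x y => ?_⟩
    induction x using Quotient.inductionOn with | h a => ?_
    induction y using Quotient.inductionOn with | h b => ?_
    obtain ⟨n, rfl⟩ := MulAction.exists_smul_eq N a b
    exact ⟨inducedHom V M n, rfl⟩
  connected := by
    obtain ⟨a⟩ := hconn.nonempty
    have h1 : ∀ v : V, (quotientGraph Γ M).Reachable (Quotient.mk _ a) (Quotient.mk _ v) := by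
      intro v
      refine hconn.forall_of_adj
        (p := fun v => (quotientGraph Γ M).Reachable (Quotient.mk _ a) (Quotient.mk _ v))
        (SimpleGraph.Reachable.refl _) (fun b c hbc hb => ?_) v
      by_cases h : (Quotient.mk _ b : MulAction.orbitRel.Quotient M V) = Quotient.mk _ c
      · rwa [← h]
      · exact hb.trans (SimpleGraph.Adj.reachable ⟨h, b, c, rfl, rfl, hbc⟩)
    refine { preconnected := fun x y => ?_, nonempty := ⟨Quotient.mk _ a⟩ }
    induction x using Quotient.inductionOn with | h b => ?_
    induction y using Quotient.inductionOn with | h c => ?_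
    exact (h1 b).symm.trans (h1 c)
  valency_le := by
    intro x
    refine ⟨Set.toFinite _, ?_⟩
    induction x using Quotient.inductionOn with | h a => ?_
    -- An edge leaving the orbit of `a` can be moved by `M` so that it starts at `a`.
    have hsub : (quotientGraph Γ M).neighborSet (Quotient.mk _ a) ⊆
        (Quotient.mk (MulAction.orbitRel M V)) '' Γ.neighborSet a := by
      rintro _ ⟨-, b, c, hb, rfl, hbc⟩
      obtain ⟨m, hm⟩ := Quotient.exact (s := MulAction.orbitRel M V) hb.symm
      refine ⟨(m : N) • c, ?_, Quotient.sound (s := MulAction.orbitRel M V) ⟨m, rfl⟩⟩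
      have := (hadj (m : N) b c).2 hbc
      rwa [show (m : N) • b = a from hm] at this
    exact (Set.ncard_le_ncard hsub (Set.toFinite _)).trans
      ((Set.ncard_image_le (Set.toFinite _)).trans (hd a))

end Pairs

/-! ### The structure of the socle and the case division. -/

section Main

theorem exists_isMinimalNormal (G : Type*) [Group G] [Finite G] [Nontrivial G] :
    ∃ K : Subgroup G, IsMinimalNormal K := by
  obtain ⟨K, hK⟩ := (Set.toFinite {K : Subgroup G | K.Normal ∧ K ≠ ⊥}).exists_minimal
    ⟨⊤, inferInstance, top_ne_bot⟩
  refine ⟨K, hK.prop.1, hK.prop.2, fun L hL hLK => ?_⟩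
  by_cases h : L = ⊥
  · exact Or.inl h
  · exact Or.inr (le_antisymm hLK (hK.le_of_le ⟨hL, h⟩ hLK))

theorem exists_isMaximalNormal (N : Type*) [Group N] [Finite N] [Nontrivial N] :
    ∃ M : Subgroup N, IsMaximalNormal M := by
  obtain ⟨M, hM⟩ := (Set.toFinite {K : Subgroup N | K.Normal ∧ K ≠ ⊤}).exists_maximal
    ⟨⊥, inferInstance, bot_ne_top⟩
  refine ⟨M, hM.prop.1, hM.prop.2, fun L hL hML => ?_⟩
  by_cases h : L = ⊤
  · exact Or.inr h
  · exact Or.inl (le_antisymm (hM.le_of_ge ⟨hL, h⟩ hML) hML)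

variable {G : Type*} [Group G]

theorem isPretransitive_of_normal_ne_bot {V : Type*} [MulAction G V] [FaithfulSMul G V]
    (hG : MulAction.IsQuasiPreprimitive G V) {K : Subgroup G} (hK : K.Normal) (h : K ≠ ⊥) :
    MulAction.IsPretransitive K V := by
  refine hG.isPretransitive_of_normal fun hfix => h ?_
  rw [eq_bot_iff]
  intro k hk
  rw [Subgroup.mem_bot]
  apply FaithfulSMul.eq_of_smul_eq_smul (α := V)
  intro v
  rw [one_smul]
  exact (hfix ▸ Set.mem_univ v : v ∈ MulAction.fixedPoints K V) ⟨k, hk⟩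

/-- The centraliser of a transitive group is semiregular. -/
theorem stabilizer_eq_bot_of_commute {V : Type*} [MulAction G V] [FaithfulSMul G V]
    {K L : Subgroup G} [MulAction.IsPretransitive L V] (h : ∀ x ∈ K, ∀ y ∈ L, Commute x y) (a : V) :
    MulAction.stabilizer K a = ⊥ := by
  rw [eq_bot_iff]
  intro k hk
  rw [Subgroup.mem_bot]
  apply Subtype.ext
  apply FaithfulSMul.eq_of_smul_eq_smul (α := V)
  intro v
  obtain ⟨y, rfl⟩ := MulAction.exists_smul_eq L a v
  have hk' : (k : G) • a = a := hk
  rw [Subgroup.smul_def, smul_smul, (h k k.2 y y.2).eq, mul_smul, hk', Subgroup.coe_one, one_smul]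

/-- The derived subgroup of `N` is normal in `G`, so minimality leaves only the abelian and the
perfect case. -/
theorem commutator_top_of_isMinimalNormal {N : Subgroup G} (hN : IsMinimalNormal N)
    (hcomm : ¬ ∀ x ∈ N, ∀ y ∈ N, Commute x y) :
    ⁅(⊤ : Subgroup N), (⊤ : Subgroup N)⁆ = ⊤ := by
  have := hN.1
  have hmap : (⊤ : Subgroup N).map N.subtype = N := by
    rw [← MonoidHom.range_eq_map, Subgroup.range_subtype]
  apply Subgroup.map_injective N.subtype_injective
  rw [Subgroup.map_commutator, hmap]
  refine (hN.2.2 ⁅N, N⁆ inferInstance (Subgroup.commutator_le_left N N)).resolve_left fun h => ?_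
  rw [Subgroup.commutator_eq_bot_iff_le_centralizer] at h
  exact hcomm fun x hx y hy => (Subgroup.mem_centralizer_iff.1 (h hx) y hy).symm

/-- Either the socle is minimal normal and perfect, or some transitive normal subgroup is
regular. -/
theorem socle_isMinimalNormal_or_exists_regular {V : Type*} [MulAction G V] [FaithfulSMul G V]
    [Finite G] [Nontrivial G] (hG : MulAction.IsQuasiPreprimitive G V) :
    (IsMinimalNormal (socle G) ∧ ⁅(⊤ : Subgroup (socle G)), (⊤ : Subgroup (socle G))⁆ = ⊤) ∨
    ∃ K : Subgroup G, K.Normal ∧ MulAction.IsPretransitive K V ∧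
      ∀ a : V, MulAction.stabilizer K a = ⊥ := by
  obtain ⟨K, hK⟩ := exists_isMinimalNormal G
  have hKtr := isPretransitive_of_normal_ne_bot hG hK.1 hK.2.1
  by_cases huniq : ∀ L : Subgroup G, IsMinimalNormal L → L = K
  · have hsoc : socle G = K := le_antisymm (sSup_le fun L hL => (huniq L hL).le) (le_sSup hK)
    by_cases hcomm : ∀ x ∈ K, ∀ y ∈ K, Commute x y
    · exact Or.inr ⟨K, hK.1, hKtr, fun a => stabilizer_eq_bot_of_commute hcomm a⟩
    · rw [hsoc]
      exact Or.inl ⟨hK, commutator_top_of_isMinimalNormal hK hcomm⟩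
  · push Not at huniq
    obtain ⟨L, hL, hne⟩ := huniq
    have := isPretransitive_of_normal_ne_bot hG hL.1 hL.2.1
    have hdis : Disjoint K L := by
      rw [disjoint_iff]
      have := hK.1
      have := hL.1
      refine (hK.2.2 (K ⊓ L) inferInstance inf_le_left).resolve_right fun h => ?_
      have hKL : K ≤ L := inf_eq_left.1 h
      rcases hL.2.2 K hK.1 hKL with h' | h'
      · exact hK.2.1 h'
      · exact hne h'.symm
    exact Or.inr ⟨K, hK.1, hKtr, fun a => stabilizer_eq_bot_of_commute
      (fun x hx y hy => Subgroup.commute_of_normal_of_disjoint K L hK.1 hL.1 hdis x y hx hy) a⟩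

/-- Frattini argument: transitivity of `M` gives `N = N_v M`. -/
theorem exists_smul_eq_and_mk_eq {V N : Type*} [Group N] [MulAction N V]
    (M : Subgroup N) [M.Normal] [MulAction.IsPretransitive M V] (v : V) (q : N ⧸ M) :
    ∃ n : N, n • v = v ∧ QuotientGroup.mk' M n = q := by
  obtain ⟨n, rfl⟩ := QuotientGroup.mk'_surjective M q
  obtain ⟨m, hm⟩ := MulAction.exists_smul_eq M v (n⁻¹ • v)
  refine ⟨n * m, ?_, ?_⟩
  · rw [mul_smul, ← Subgroup.smul_def, hm, smul_inv_smul]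
  · simp

/-- The argument needs only `r ^ d` here; the exponent `2 * d` in `hatFun` leaves slack. -/
theorem mul_pow_le_hatFun_exponent {d r : ℕ} (hr : 0 < r) : (d * r) ^ d ≤ d ^ d * r ^ (2 * d) := by
  rw [mul_pow]
  exact Nat.mul_le_mul_left _ (Nat.pow_le_pow_right hr (by omega))

theorem mainTheorem1 {V : Type u} [Finite V] (d : ℕ) (hd : 0 < d)
    (Γ : SimpleGraph V) (G : Subgroup (Equiv.Perm V)) (hΓG : InFamily d Γ G)
    (hG : MulAction.IsQuasiPreprimitive G V)
    (T : Type v) [Group T] (hT : IsSocleFactor G T) :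
    IsBoundedBy (fun n => (n * n !)!) d G ∨
    ∃ (W : Type u) (Λ : SimpleGraph W) (H : Subgroup (Equiv.Perm W)),
      IsSocleQuotientPair Γ G Λ H ∧
      (∀ (V' W' : Type u) (Γ' : SimpleGraph V') (G' : Subgroup (Equiv.Perm V'))
        (Λ' : SimpleGraph W') (H' : Subgroup (Equiv.Perm W')),
        PairIso Γ G Γ' G' → IsSocleQuotientPair Γ' G' Λ' H' → PairIso Λ H Λ' H') ∧
      Nonempty (H ≃* T) ∧
      InFamily d Λ H ∧
      (∀ g : ℕ → ℕ, IsBoundedBy g d H → IsBoundedBy (hatFun g) d G) ∧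
      (∀ f : ℕ → ℕ, IsBoundedBy f d G → IsBoundedBy f d H) := by
  have hadj : ∀ (g : G) a b, Γ.Adj (g • a) (g • b) ↔ Γ.Adj a b := fun g => hΓG.le_aut g.2
  have hconn := hΓG.connected
  have hval : ∀ v, (Γ.neighborSet v).ncard ≤ d := fun v => (hΓG.valency_le v).2
  rcases subsingleton_or_nontrivial G with hsub | hnt
  · left
    intro a
    refine ⟨inferInstance, ?_⟩
    rw [Nat.card_eq_one_iff_unique.2 ⟨inferInstance, inferInstance⟩]
    exact Nat.factorial_pos _
  have hbound : ∀ K : Subgroup G, K.Normal → MulAction.IsPretransitive K V →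
      (∀ a : V, Nat.card (MulAction.stabilizer K a) ≤ d !) →
      IsBoundedBy (fun n => (n * n !)!) d G := fun K _ _ hK a => ⟨inferInstance,
    (card_stabilizer_le_of_normal (N := K) hadj hconn (hval a)).trans
      (Nat.factorial_le (Nat.mul_le_mul_left _ (hK a)))⟩
  rcases socle_isMinimalNormal_or_exists_regular hG with ⟨hN, hperf⟩ | ⟨K, hK, hKtr, hKst⟩
  swap
  · left
    refine hbound K hK hKtr fun a => ?_
    rw [hKst a, Subgroup.card_bot]
    exact Nat.factorial_pos _
  have hNn := hN.1
  have hNtr := isPretransitive_of_normal_ne_bot hG hN.1 hN.2.1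
  have := (Subgroup.nontrivial_iff_ne_bot _).2 hN.2.1
  have hadjN : ∀ (n : socle G) a b, Γ.Adj (n • a) (n • b) ↔ Γ.Adj a b := fun n => hadj n
  obtain ⟨M, hM⟩ := exists_isMaximalNormal (socle G)
  have := hM.1
  by_cases hMtr : MulAction.IsPretransitive M V
  · left
    have hsurj := QuotientGroup.mk'_surjective M
    have := isSimpleGroup_of_isMaximalNormal_ker hsurj (by rwa [QuotientGroup.ker_mk'])
    refine hbound _ hN.1 hNtr fun a => ?_
    exact card_stabilizer_le_factorial_of_ballStabilizer hadjN (hval a)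
      (ballStabilizer_eq_bot hadj hconn (map_commutator_top hsurj hperf)
        (fun n hn => eq_bot_of_forall_mem_ker_twist hN hsurj hn) (exists_smul_eq_and_mk_eq M) a)
  right
  have hsurj := inducedHom_surjective (V := V) M
  have hker : (inducedHom V M).ker = M := ker_inducedHom M hM hMtr
  have hsimple := isSimpleGroup_of_isMaximalNormal_ker hsurj (by rwa [hker])
  refine ⟨_, quotientGraph Γ M, inducedGroup V M, ⟨M, hM, PairIso.refl _ _⟩, ?_, ?_,
    inFamily_quotient M hadjN hconn hval, ?_, ?_⟩
  · rintro V' W' Γ' G' Λ' H' hiso ⟨M', hM', hquot⟩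
    refine PairIso.trans ?_ hquot
    obtain ⟨e, τ, he, hτ⟩ := hiso.exists_socle_equiv
    -- Pulled back along the isomorphism, `M'` becomes a `G`-conjugate of `M`, and the conjugating
    -- element is itself an automorphism of `Γ`.
    obtain ⟨g, hg⟩ := exists_conj_of_isMaximalNormal hN hperf hM (hM'.comap τ)
    refine pairIso_quotient ((MulAction.toPerm g).trans e) (fun a b => ?_)
      ((MulAut.conjNormal g).trans τ) (fun n v => ?_) hg
    · exact (he _ _).trans (hadj g a b)
    · change e (g • n • v) = τ (MulAut.conjNormal g n) • e (g • v)
      rw [← hτ, conjNormal_smul, inv_smul_smul]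
  · obtain ⟨hTs, l, ⟨χ⟩⟩ := hT
    exact nonempty_mulEquiv_of_surjective_pi ((inducedHom V M).comp χ.symm.toMonoidHom)
      (hsurj.comp χ.symm.surjective)
  · intro g hg a
    refine ⟨inferInstance, (card_stabilizer_le_of_normal (N := socle G) hadj hconn (hval a)).trans
      (Nat.factorial_le (Nat.mul_le_mul_left _ ?_))⟩
    have hst := stabilizer_inducedGroup M a
    have hr := (hg (Quotient.mk _ a)).2
    rw [hst] at hr
    have hr0 : 0 < g d := Nat.card_pos.trans_le hr
    refine (card_stabilizer_le_pow hadj hconn hd (hval a) hsurj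
      (fun n hn => eq_bot_of_forall_mem_ker_twist hN hsurj hn) (fun htop => hMtr ?_) hr).trans
      (Nat.pow_le_pow_right hr0 (mul_pow_le_hatFun_exponent hr0))
    -- If `N_a` mapped onto the induced group, then `N = M N_a` and `M` would be transitive.
    have key : ∀ b : V, ∃ m : M, m • a = b := by
      intro b
      obtain ⟨n, rfl⟩ := MulAction.exists_smul_eq (socle G) a b
      obtain ⟨x, hx, hxn⟩ : inducedHom V M n ∈ (MulAction.stabilizer (socle G) a).map _ :=
        htop ▸ Subgroup.mem_top _
      refine ⟨⟨n * x⁻¹, ?_⟩, ?_⟩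
      · rw [← hker, MonoidHom.mem_ker, map_mul, map_inv, hxn, mul_inv_cancel]
      · change (n * x⁻¹) • a = n • a
        rw [mul_smul, smul_left_cancel_iff, inv_smul_eq_iff]
        exact (MulAction.mem_stabilizer_iff.1 hx).symm
    refine ⟨fun b c => ?_⟩
    obtain ⟨m, rfl⟩ := key b
    obtain ⟨k, rfl⟩ := key c
    exact ⟨k * m⁻¹, by rw [mul_smul, inv_smul_smul]⟩
  · intro f hf x
    induction x using Quotient.inductionOn with | h a => ?_
    refine ⟨inferInstance, ?_⟩
    rw [stabilizer_inducedGroup]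
    refine le_trans ?_ (hf a).2
    refine (Nat.card_le_card_of_surjective _
      ((inducedHom V M).subgroupMap_surjective (MulAction.stabilizer (socle G) a))).trans ?_
    refine Nat.card_le_card_of_injective
      (fun n : MulAction.stabilizer (socle G) a =>
        (⟨((n : socle G) : G), n.2⟩ : MulAction.stabilizer G a)) fun m n h => ?_
    have h' : ((m : socle G) : G) = ((n : socle G) : G) :=
      congrArg (Subtype.val (p := fun x => x ∈ MulAction.stabilizer G a)) h
    exact Subtype.ext (Subtype.ext h')

end Main
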